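/- Let $d \ge 1$ and $\lambda = (2,2,\ldots,2)$ ($d$ parts). Let $$\widetilde{\mathcal P}_{d+1}(\lambda) = \operatorname{conv}\{(x,\, x_1^2+\cdots+x_d^2) : x \in \mathbb Z^d,\ 0 \le x_i \le 2 \text{ for } 1 \le i \le d\} \subset \mathbb R^{d+1},$$ the lifted pile of cubes corresponding to $\lambda$, and let $\pi : \widetilde{\mathcal P}_{d+1}(\lambda) \to Q = [0,2d]$ be the projection $\pi(x) = x_1 + \cdots + x_d$ (the sum of the first $d$ coordinates). Let $$\Pi_d(\lambda) = \Big\{ \tfrac{1}{\operatorname{vol}(Q)} \int_Q \gamma(t)\, dt \ :\ \gamma \text{ is a section of } \pi \Big\} \subset \mathbb R^{d+1}$$ be the monotone path polytope of $\pi$, where a section of $\pi$ is a continuous map $\gamma : Q \to \widetilde{\mathcal P}_{d+1}(\lambda)$ with $\pi(\gamma(t)) = t$ for all $t \in Q$. A lower face of a polytope in $\mathbb R^{d+1}$ is a nonempty face on which some linear functional $c(x) = a_1x_1 + \cdots + a_{d+1}x_{d+1}$ with $a_{d+1} > 0$ attains its minimum over the polytope, the face being the set of all minimizers. Then for every $1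 \le k \le d$ the number of lower faces of $\Pi_d(\lambda)$ of dimension $d-k$ is $$\sum_{r=k}^{d} (r-1)!\, S(d,r) \binom{r}{k} \binom{r+k}{k-1},$$ where $S(d,r)$ denotes a Stirling number of the second kind. -/

import Mathlib

open scoped Nat

/-- The `d`-box `B(λ)` of all points `x` of `ℝ^d` with `0 ≤ x_i ≤ λ_i` for all `i`. -/
def dBox {d : ℕ} (lam : Fin d → ℕ) : Set (Fin d → ℝ) :=
  {x | ∀ i, 0 ≤ x i ∧ x i ≤ (lam i : ℝ)}

/-- The vertex set of the pile of cubes: the integer points of the `d`-box. -/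
def pileVertices {d : ℕ} (lam : Fin d → ℕ) : Set (Fin d → ℝ) :=
  {x | x ∈ dBox lam ∧ ∀ i, ∃ m : ℤ, x i = (m : ℝ)}

/-- The lifted pile of cubes, the convex hull of the points `(x, x_1 ^ 2 + ⋯ + x_d ^ 2)` for the
vertices `x` of the pile of cubes. Here `ℝ^(d+1)` is written as `ℝ^d × ℝ`. -/
def liftedPile {d : ℕ} (lam : Fin d → ℕ) : Set ((Fin d → ℝ) × ℝ) :=
  convexHull ℝ ((fun x : Fin d → ℝ => (x, ∑ i, x i ^ 2)) '' pileVertices lam)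

/-- The sum of the first `d` coordinates of a point of `ℝ^(d+1)`. -/
def coordSum {d : ℕ} (p : (Fin d → ℝ) × ℝ) : ℝ := ∑ i, p.1 i

/-- `γ` is a section of the projection `π : P → π(P)`: it is continuous on `π(P)`, maps `π(P)` to
`P`, and `π ∘ γ` is the identity on `π(P)`. -/
def IsSectionOf {E : Type*} [TopologicalSpace E] (P : Set E) (π : E → ℝ) (γ : ℝ → E) : Prop :=
  ContinuousOn γ (π '' P) ∧ ∀ t ∈ π '' P, γ t ∈ P ∧ π (γ t) = t

/-- The monotone path polytope of a projection `π` of a polytope `P` onto a segment `Q = π(P)`: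
the set of the averages `(1 / vol Q) ∫_Q γ(t) dt` of all sections `γ` of `π`. -/
noncomputable def monotonePathPolytope {E : Type*} [NormedAddCommGroup E] [NormedSpace ℝ E]
    (P : Set E) (π : E → ℝ) : Set E :=
  {y | ∃ γ : ℝ → E, IsSectionOf P π γ ∧
    y = (MeasureTheory.volume (π '' P)).toReal⁻¹ • ∫ t in π '' P, γ t}

/-- The monotone path polytope `Π_d(λ)` of the lifted pile of cubes and the projection given by the
sum of the first `d` coordinates. -/
noncomputable def pilePathPolytope {d : ℕ} (lam : Fin d → ℕ) : Set ((Fin d → ℝ) × ℝ) :=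
  monotonePathPolytope (liftedPile lam) coordSum

/-- `F` is a lower face of the polytope `P` in `ℝ^d × ℝ`: a nonempty face which is the set of
minimizers on `P` of a linear functional whose coefficient at the last coordinate is positive. -/
def IsLowerFace {d : ℕ} (P F : Set ((Fin d → ℝ) × ℝ)) : Prop :=
  F.Nonempty ∧ ∃ c : ((Fin d → ℝ) × ℝ) →ₗ[ℝ] ℝ, 0 < c (0, 1) ∧
    F = {x | x ∈ P ∧ ∀ y ∈ P, c x ≤ c y}

/-- The dimension of a nonempty face, that is, of its affine hull. -/
noncomputable def faceDim {d : ℕ} (F : Set ((Fin d → ℝ) × ℝ)) : ℕ :=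
  Module.finrank ℝ (vectorSpan ℝ F)

/-!
Cut the segment `[0, λ_i]` of every coordinate into unit boxes `[j, j + 1]`, and give such a box the
price `a_i + 2 j + 1`, which is what crossing it costs for the functional with coefficients
`(a, 1)`. At every time `t` the cheapest point of the lifted pile over `t` is obtained by filling
boxes greedily, in the order of their prices, and the average of a section is minimal exactly when
the section is greedy all the time. So the lower faces of `Π_d(λ)` correspond to the weak orders of
the boxes by price, and the face of `a` lies in the face of `a'` exactly when the price order of `a`
refines that of `a'`. Small perturbations of `a` therefore show that its face has dimension `d - m`,
where `m` is the dimension of the space of directions which preserve all ties between prices.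

For `λ = (2, …, 2)` the prices are, up to a common constant, the numbers `a_i` and `a_i + 2`. If `a`
takes `r` values `b_1 < ⋯ < b_r`, it is determined by these and a surjection onto them, one of
`r! S(d, r)`. Of the values `b_j` only the positions of the `b_i + 2` among them matter; each
equality `b_i + 2 = b_j` lowers `m`, at first `r`, by one. The positions are recorded by a code,
that is, a ballot sequence with marks, and the codes with `r - k` marks are counted by a recursion
that gives `1 / r * (r choose k) * (r + k choose k - 1)`.
-/

section Greedy

variable {ι : Type*} {s y g : ι → ℝ}

/-- The filling `y` of the boxes `ι` uses cheap boxes first: where the price is `s`, a box is used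
only if all strictly cheaper boxes are full. -/
def Greedy (s y : ι → ℝ) : Prop := ∀ α β, s α < s β → 0 < y β → y α = 1

theorem Greedy.exists_threshold [Finite ι] (h : Greedy s y) (h0 : 0 ≤ y) :
    ∃ μ, (∀ α, s α < μ → y α = 1) ∧ ∀ α, μ < s α → y α = 0 := by
  by_cases hne : ∃ β, 0 < y β
  · obtain ⟨β, hβ, hmax⟩ := Set.exists_max_image {β | 0 < y β} s (Set.toFinite _) hne
    exact ⟨s β, fun α hα => h α β hα hβ,
      fun α hα => (not_lt.1 fun hy => (hmax α hy).not_gt hα).antisymm (h0 α)⟩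
  · push Not at hne
    obtain ⟨μ, hμ⟩ := (Set.finite_range s).bddBelow
    exact ⟨μ, fun α hα => absurd (hμ ⟨α, rfl⟩) hα.not_ge, fun α _ => (hne α).antisymm (h0 α)⟩

theorem threshold_mul_nonneg {μ : ℝ} (hg : g ∈ Set.Icc 0 1) (h1 : ∀ α, s α < μ → y α = 1)
    (h2 : ∀ α, μ < s α → y α = 0) (α : ι) : 0 ≤ (s α - μ) * (g α - y α) := by
  rcases lt_trichotomy (s α) μ with hα | hα | hα
  · rw [h1 α hα]
    exact mul_nonneg_of_nonpos_of_nonpos (sub_nonpos.2 hα.le) (sub_nonpos.2 (hg.2 α))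
  · simp [hα]
  · rw [h2 α hα, sub_zero]
    exact mul_nonneg (sub_nonneg.2 hα.le) (hg.1 α)

variable [Fintype ι]

theorem sum_sub_mul_sub (hsum : ∑ α, y α = ∑ α, g α) (μ : ℝ) :
    ∑ α, (s α - μ) * (g α - y α) = ∑ α, s α * g α - ∑ α, s α * y α := by
  simp only [mul_sub, sub_mul, Finset.sum_sub_distrib, ← Finset.mul_sum, hsum]
  ring

theorem Greedy.sum_mul_le (h : Greedy s y) (hy : 0 ≤ y) (hg : g ∈ Set.Icc 0 1)
    (hsum : ∑ α, y α = ∑ α, g α) : ∑ α, s α * y α ≤ ∑ α, s α * g α := by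
  obtain ⟨μ, h1, h2⟩ := h.exists_threshold hy
  rw [← sub_nonneg, ← sum_sub_mul_sub hsum μ]
  exact Finset.sum_nonneg fun α _ => threshold_mul_nonneg hg h1 h2 α

theorem Greedy.of_sum_mul_eq (h : Greedy s y) (hy : 0 ≤ y) (hg : g ∈ Set.Icc 0 1)
    (hsum : ∑ α, y α = ∑ α, g α) (heq : ∑ α, s α * y α = ∑ α, s α * g α) : Greedy s g := by
  obtain ⟨μ, h1, h2⟩ := h.exists_threshold hy
  have hzero : ∀ α, s α ≠ μ → g α = y α := by
    intro α hα
    have := (Finset.sum_eq_zero_iff_of_nonneg fun α _ => threshold_mul_nonneg hg h1 h2 α).1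
      ((sum_sub_mul_sub hsum μ).trans (sub_eq_zero.2 heq.symm)) α (Finset.mem_univ α)
    exact sub_eq_zero.1 ((mul_eq_zero.1 this).resolve_left (sub_ne_zero.2 hα))
  intro α β hαβ hβ
  have hβμ : s β ≤ μ := by
    by_contra! hlt
    rw [hzero β hlt.ne', h2 β hlt] at hβ
    exact hβ.false
  have hαμ : s α < μ := hαβ.trans_le hβμ
  rw [hzero α hαμ.ne, h1 α hαμ]

end Greedy

section Ramp

/-- The truncation of a real number to the unit interval. -/
noncomputable def ramp (u : ℝ) : ℝ := max 0 (min 1 u)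

theorem ramp_of_nonpos {u : ℝ} (h : u ≤ 0) : ramp u = 0 :=
  max_eq_left ((min_le_right _ _).trans h)

theorem ramp_of_one_le {u : ℝ} (h : 1 ≤ u) : ramp u = 1 := by
  rw [ramp, min_eq_left h, max_eq_right zero_le_one]

theorem ramp_of_mem {u : ℝ} (h : u ∈ Set.Icc (0 : ℝ) 1) : ramp u = u := by
  rw [ramp, min_eq_right h.2, max_eq_right h.1]

theorem ramp_natCast_sub (n m : ℕ) : ramp (n - m : ℝ) = if m < n then 1 else 0 := by
  split_ifs with h
  · exact ramp_of_one_le (le_sub_iff_add_le'.2 (by exact_mod_cast h))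
  · exact ramp_of_nonpos (sub_nonpos.2 (by exact_mod_cast not_lt.1 h))

theorem ramp_natCast_add_sub (n m : ℕ) {u : ℝ} (hu : u ∈ Set.Icc (0 : ℝ) 1) :
    ramp (n + u - m) = (1 - u) * ramp (n - m) + u * ramp ((n + 1 : ℕ) - m) := by
  obtain ⟨h0, h1⟩ := hu
  rw [ramp_natCast_sub, ramp_natCast_sub]
  rcases lt_trichotomy m n with h | rfl | h
  · have : (m : ℝ) + 1 ≤ n := by exact_mod_cast h
    rw [ramp_of_one_le (by linarith), if_pos h, if_pos (h.trans n.lt_succ_self)]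
    ring
  · rw [ramp_of_mem ⟨by linarith, by linarith⟩, if_neg (lt_irrefl m), if_pos m.lt_succ_self]
    ring
  · have : (n : ℝ) + 1 ≤ m := by exact_mod_cast h
    rw [ramp_of_nonpos (by linarith), if_neg h.not_gt, if_neg (by lia)]
    ring

theorem continuous_ramp : Continuous ramp := by
  unfold ramp; fun_prop

theorem sum_ramp (n : ℕ) {t : ℝ} (ht : 0 ≤ t) :
    ∑ m ∈ Finset.range n, ramp (t - m) = min t n := by
  induction n with
  | zero => simp [ht]
  | succ n ih =>
    rw [Finset.sum_range_succ, ih, Nat.cast_succ]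
    rcases le_total t n with h | h
    · rw [ramp_of_nonpos (by linarith), min_eq_left h, min_eq_left (by linarith), add_zero]
    rcases le_total t (n + 1) with h' | h'
    · rw [ramp_of_mem ⟨by linarith, by linarith⟩, min_eq_right h, min_eq_left h']
      ring
    · rw [ramp_of_one_le (by linarith), min_eq_right h, min_eq_right h']

variable {ι : Type*} {N : ℕ} {s : ι → ℝ} {pos : ι ≃ Fin N}

/-- The enumeration `pos` of the boxes `ι` lists them in the order of their prices `s`. -/
def SortedBy (s : ι → ℝ) (pos : ι ≃ Fin N) : Prop := ∀ α β, pos α < pos β → s α ≤ s β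

theorem exists_sortedBy [Fintype ι] (hN : Fintype.card ι = N) (s : ι → ℝ) :
    ∃ pos : ι ≃ Fin N, SortedBy s pos := by
  let e := Fintype.equivFinOfCardEq hN
  refine ⟨e.trans (Tuple.sort (s ∘ e.symm)).symm, fun α β h => ?_⟩
  simpa using Tuple.monotone_sort (s ∘ e.symm) h.le

theorem SortedBy.lt_of_lt (h : SortedBy s pos) {α β : ι} (hαβ : s α < s β) : pos α < pos β := by
  by_contra! hle
  rcases hle.lt_or_eq with hlt | heq
  · exact (h β α hlt).not_gt hαβ
  · exact hαβ.ne (congrArg s (pos.injective heq.symm))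

theorem SortedBy.swap [DecidableEq ι] (h : SortedBy s pos) {α β : ι} (hαβ : s α = s β) :
    SortedBy s ((Equiv.swap α β).trans pos) := by
  have hs : ∀ γ, s (Equiv.swap α β γ) = s γ := fun γ => by
    rw [Equiv.swap_apply_def]; split_ifs <;> simp_all
  intro γ δ hγδ
  simpa only [hs] using h _ _ hγδ

theorem exists_sortedBy_lt [Fintype ι] (hN : Fintype.card ι = N) {α β : ι} (hne : α ≠ β)
    (hle : s α ≤ s β) : ∃ pos : ι ≃ Fin N, SortedBy s pos ∧ pos α < pos β := by
  classical
  obtain ⟨pos, hpos⟩ := exists_sortedBy hN s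
  rcases lt_or_gt_of_ne (pos.injective.ne hne) with h | h
  · exact ⟨pos, hpos, h⟩
  · exact ⟨_, hpos.swap (hle.antisymm (hpos _ _ h)), by simpa using h⟩

/-- The filling at time `t` when the boxes are filled at unit speed, one after the other, in the
order `pos`. -/
noncomputable def rampFill (pos : ι ≃ Fin N) (t : ℝ) (α : ι) : ℝ := ramp (t - (pos α : ℕ))

theorem rampFill_mem_Icc (pos : ι ≃ Fin N) (t : ℝ) : rampFill pos t ∈ Set.Icc 0 1 :=
  ⟨fun _ => le_max_left _ _, fun _ => max_le zero_le_one (min_le_left _ _)⟩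

theorem continuous_rampFill (pos : ι ≃ Fin N) : Continuous (rampFill pos) :=
  continuous_pi fun _ => continuous_ramp.comp (continuous_sub_right _)

theorem sum_rampFill [Fintype ι] (pos : ι ≃ Fin N) {t : ℝ} (ht : t ∈ Set.Icc (0 : ℝ) N) :
    ∑ α, rampFill pos t α = t := by
  simp only [rampFill]
  rw [pos.sum_comp (fun m : Fin N => ramp (t - (m : ℕ))),
    Fin.sum_univ_eq_sum_range (fun m : ℕ => ramp (t - m)) N, sum_ramp N ht.1, min_eq_left ht.2]

theorem SortedBy.greedy_rampFill (h : SortedBy s pos) (t : ℝ) : Greedy s (rampFill pos t) := by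
  intro α β hαβ hβ
  have hlt : ((pos α : ℕ) : ℝ) + 1 ≤ (pos β : ℕ) := by exact_mod_cast h.lt_of_lt hαβ
  have hβt : ((pos β : ℕ) : ℝ) < t := by
    by_contra! hle
    exact hβ.ne' (ramp_of_nonpos (sub_nonpos.2 hle))
  exact ramp_of_one_le (by linarith)

theorem rampFill_natCast_add (pos : ι ≃ Fin N) (n : ℕ) {u : ℝ} (hu : u ∈ Set.Icc (0 : ℝ) 1) :
    rampFill pos (n + u) = (1 - u) • rampFill pos n + u • rampFill pos (n + 1 : ℕ) :=
  funext fun α => ramp_natCast_add_sub n (pos α) hu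

end Ramp

section Stack

variable {ι : Type*}

theorem mem_Icc_of_eq_zero_or_one {α : Type*} {y : α → ℝ} (h : ∀ x, y x = 0 ∨ y x = 1) :
    y ∈ Set.Icc 0 1 :=
  ⟨fun x => (h x).elim (fun hx => hx.ge) fun hx => hx ▸ zero_le_one,
    fun x => (h x).elim (fun hx => hx ▸ zero_le_one) fun hx => hx.le⟩

/-- The boxes of a pile: the coordinate direction `i` carries the `lam i` unit boxes
`[j, j + 1]`. -/
abbrev PileBox (lam : ι → ℕ) : Type _ := (i : ι) × Fin (lam i)

theorem card_pileBox [Fintype ι] (lam : ι → ℕ) : Fintype.card (PileBox lam) = ∑ i, lam i := by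
  simp [Fintype.card_sigma]

/-- The price of a box for the functional with coefficients `a` and `1`: passing from `j` to
`j + 1` in direction `i` raises `x_i` by `1` and `x_i ^ 2` by `2 * j + 1`. -/
def price {lam : ι → ℕ} (a : ι → ℝ) (α : PileBox lam) : ℝ := a α.1 + (2 * (α.2 : ℕ) + 1)

/-- The functional on `ℝ^d × ℝ` with coefficients `a` and `1`. -/
def pileCost [Fintype ι] (a : ι → ℝ) : ((ι → ℝ) × ℝ) →ₗ[ℝ] ℝ :=
  (dotProductBilin ℝ ℝ a).coprod LinearMap.id

theorem pileCost_apply [Fintype ι] (a : ι → ℝ) (p : (ι → ℝ) × ℝ) :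
    pileCost a p = a ⬝ᵥ p.1 + p.2 := rfl

variable [Fintype ι] {lam : ι → ℕ}

/-- The point of `ℝ^d × ℝ` reached by a filling of the boxes. Over the integral points this is the
lifting `x ↦ (x, x_1 ^ 2 + ⋯ + x_d ^ 2)`, if the boxes of each direction are filled in order. -/
def stack : (PileBox lam → ℝ) →ₗ[ℝ] (ι → ℝ) × ℝ where
  toFun y := (fun i => ∑ j, y ⟨i, j⟩, ∑ α, (2 * (α.2 : ℕ) + 1) * y α)
  map_add' y z := by ext <;> simp [Finset.sum_add_distrib, mul_add]
  map_smul' c y := by ext <;> simp [Finset.mul_sum, mul_left_comm]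

theorem stack_fst (y : PileBox lam → ℝ) (i : ι) : (stack y).1 i = ∑ j, y ⟨i, j⟩ := rfl

theorem stack_snd (y : PileBox lam → ℝ) :
    (stack y).2 = ∑ i, ∑ j : Fin (lam i), (2 * (j : ℕ) + 1) * y ⟨i, j⟩ :=
  Fintype.sum_sigma _

theorem pileCost_stack (a : ι → ℝ) (y : PileBox lam → ℝ) :
    pileCost a (stack y) = ∑ α, price a α * y α := by
  rw [pileCost_apply, dotProduct, stack_snd, Fintype.sum_sigma, ← Finset.sum_add_distrib]
  simp only [stack_fst, price, add_mul, Finset.sum_add_distrib, Finset.mul_sum]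

theorem coordSum_stack {d : ℕ} {lam : Fin d → ℕ} (y : PileBox lam → ℝ) :
    coordSum (stack y) = ∑ α, y α := by
  rw [Fintype.sum_sigma]; rfl

theorem sum_odd_mul_eq_sq {n : ℕ} {y : Fin n → ℝ} (h01 : ∀ j, y j = 0 ∨ y j = 1)
    (hy : ∀ i j, i < j → y j = 1 → y i = 1) :
    ∑ j : Fin n, (2 * (j : ℕ) + 1) * y j = (∑ j, y j) ^ 2 := by
  induction n with
  | zero => simp
  | succ n ih =>
    rw [Fin.sum_univ_castSucc, Fin.sum_univ_castSucc]
    have := ih (y := fun j => y j.castSucc) (fun j => h01 _)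
      fun i j hij => hy _ _ (Fin.castSucc_lt_castSucc_iff.2 hij)
    simp only [Fin.val_castSucc, Fin.val_last, this]
    rcases h01 (Fin.last n) with h | h
    · simp [h]
    · have hsum : ∑ j : Fin n, y j.castSucc = n := by
        simp [hy _ _ (Fin.castSucc_lt_last _) h]
      rw [hsum, h]
      ring

theorem stack_eq_of_layered {y : PileBox lam → ℝ} (h01 : ∀ α, y α = 0 ∨ y α = 1)
    (hy : ∀ i j j', j < j' → y ⟨i, j'⟩ = 1 → y ⟨i, j⟩ = 1) :
    stack y = ((stack y).1, ∑ i, (stack y).1 i ^ 2) := by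
  refine Prod.ext rfl ?_
  simp only [stack_snd, stack_fst]
  exact Finset.sum_congr rfl fun i _ => sum_odd_mul_eq_sq (fun j => h01 _) (hy i)

variable {d : ℕ} {lam : Fin d → ℕ}

theorem stack_mem_liftedPile_of_layered {y : PileBox lam → ℝ} (h01 : ∀ α, y α = 0 ∨ y α = 1)
    (hy : ∀ i j j', j < j' → y ⟨i, j'⟩ = 1 → y ⟨i, j⟩ = 1) : stack y ∈ liftedPile lam := by
  obtain ⟨hy0, hy1⟩ := mem_Icc_of_eq_zero_or_one h01
  refine subset_convexHull ℝ _ ⟨(stack y).1, ⟨fun i => ⟨?_, ?_⟩, fun i => ?_⟩,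
    (stack_eq_of_layered h01 hy).symm⟩
  · rw [stack_fst]
    exact Finset.sum_nonneg fun j _ => hy0 _
  · rw [stack_fst]
    exact (Finset.sum_le_sum fun j _ => hy1 ⟨i, j⟩).trans_eq (by simp)
  · choose m hm using fun α => show ∃ m : ℤ, y α = m from
      (h01 α).elim (fun h => ⟨0, by simp [h]⟩) fun h => ⟨1, by simp [h]⟩
    exact ⟨∑ j, m ⟨i, j⟩, by simp [stack, hm]⟩

theorem liftedPile_subset_image_stack :
    liftedPile lam ⊆ stack '' Set.Icc (0 : PileBox lam → ℝ) 1 := by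
  refine convexHull_min ?_ ((convex_Icc 0 1).linear_image stack)
  rintro _ ⟨x, ⟨hx, hint⟩, rfl⟩
  choose m hm using hint
  let y : PileBox lam → ℝ := fun α => if (α.2 : ℕ) < m α.1 then 1 else 0
  have h01 : ∀ α, y α = 0 ∨ y α = 1 := fun α => (ite_eq_or_eq _ _ _).symm
  have hlayered : ∀ i j j', j < j' → y ⟨i, j'⟩ = 1 → y ⟨i, j⟩ = 1 := by
    simp only [y, ite_eq_left_iff, zero_ne_one, imp_false, not_not]
    exact fun i j j' hj h => lt_trans (by exact_mod_cast hj) h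
  have hfst : (stack y).1 = x := by
    ext i
    have h0 : 0 ≤ m i := by exact_mod_cast (hm i ▸ hx i).1
    have h1 : m i ≤ lam i := by exact_mod_cast (hm i ▸ hx i).2
    lift m i to ℕ using h0 with n hn
    rw [stack_fst, hm, ← hn]
    simp only [y, ← hn, Nat.cast_lt, Finset.sum_boole]
    simp [Fin.card_filter_val_lt, Nat.cast_le.1 h1]
  exact ⟨y, mem_Icc_of_eq_zero_or_one h01, by rw [stack_eq_of_layered h01 hlayered, hfst]⟩

end Stack

section Stair

variable {d N : ℕ} {lam : Fin d → ℕ} {a b : Fin d → ℝ} {p q : (Fin d → ℝ) × ℝ}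
  {pos : PileBox lam ≃ Fin N}

/-- The points that minimize `pileCost a` in their fibre of `coordSum`, encoded as the points that
a greedy filling of the boxes reaches. -/
def PileOptimal (lam : Fin d → ℕ) (a : Fin d → ℝ) (p : (Fin d → ℝ) × ℝ) : Prop :=
  ∃ y ∈ Set.Icc (0 : PileBox lam → ℝ) 1, Greedy (price a) y ∧ stack y = p

theorem PileOptimal.mono (h : ∀ α β : PileBox lam, price a α < price a β → price b α < price b β)
    (hp : PileOptimal lam b p) : PileOptimal lam a p :=
  hp.imp fun _ ⟨hy, hb, hyp⟩ => ⟨hy, fun α β hαβ => hb α β (h α β hαβ), hyp⟩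

theorem PileOptimal.pileCost_le_stack (hp : PileOptimal lam a p) {g : PileBox lam → ℝ}
    (hg : g ∈ Set.Icc 0 1) (hsum : coordSum p = coordSum (stack g)) :
    pileCost a p ≤ pileCost a (stack g) := by
  obtain ⟨y, hy, hgreedy, rfl⟩ := hp
  simp only [pileCost_stack, coordSum_stack] at hsum ⊢
  exact hgreedy.sum_mul_le hy.1 hg hsum

theorem PileOptimal.greedy_of_pileCost_eq (hp : PileOptimal lam a p) {g : PileBox lam → ℝ}
    (hg : g ∈ Set.Icc 0 1) (hsum : coordSum p = coordSum (stack g))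
    (hcost : pileCost a p = pileCost a (stack g)) : Greedy (price a) g := by
  obtain ⟨y, hy, hgreedy, rfl⟩ := hp
  simp only [pileCost_stack, coordSum_stack] at hsum hcost
  exact hgreedy.of_sum_mul_eq hy.1 hg hsum hcost

theorem PileOptimal.greedy {g : PileBox lam → ℝ} (h : PileOptimal lam a (stack g))
    (hg : g ∈ Set.Icc 0 1) : Greedy (price a) g :=
  h.greedy_of_pileCost_eq hg rfl rfl

theorem PileOptimal.pileCost_le (hp : PileOptimal lam a p) (hq : q ∈ liftedPile lam)
    (hsum : coordSum p = coordSum q) : pileCost a p ≤ pileCost a q := by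
  obtain ⟨g, hg, rfl⟩ := liftedPile_subset_image_stack hq
  exact hp.pileCost_le_stack hg hsum

theorem PileOptimal.iff_pileCost_eq (hp : PileOptimal lam a p) (hp' : p ∈ liftedPile lam)
    (hq : q ∈ liftedPile lam) (hsum : coordSum p = coordSum q) :
    PileOptimal lam a q ↔ pileCost a q = pileCost a p := by
  refine ⟨fun h => (h.pileCost_le hp' hsum.symm).antisymm (hp.pileCost_le hq hsum), fun h => ?_⟩
  obtain ⟨g, hg, rfl⟩ := liftedPile_subset_image_stack hq
  exact ⟨g, hg, hp.greedy_of_pileCost_eq hg hsum h.symm, rfl⟩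

/-- The path in `ℝ^d × ℝ` traced by filling the boxes one after the other in the order `pos`. -/
noncomputable def stairPath (pos : PileBox lam ≃ Fin N) (t : ℝ) : (Fin d → ℝ) × ℝ :=
  stack (rampFill pos t)

theorem continuous_stairPath (pos : PileBox lam ≃ Fin N) : Continuous (stairPath pos) :=
  stack.continuous_of_finiteDimensional.comp (continuous_rampFill pos)

theorem coordSum_stairPath (pos : PileBox lam ≃ Fin N) {t : ℝ} (ht : t ∈ Set.Icc (0 : ℝ) N) :
    coordSum (stairPath pos t) = t := by
  rw [stairPath, coordSum_stack, sum_rampFill pos ht]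

theorem SortedBy.pileOptimal_stairPath (h : SortedBy (price a) pos) (t : ℝ) :
    PileOptimal lam a (stairPath pos t) :=
  ⟨_, rampFill_mem_Icc pos t, h.greedy_rampFill t, rfl⟩

theorem SortedBy.stairPath_natCast_mem (h : SortedBy (price a) pos) (n : ℕ) :
    stairPath pos n ∈ liftedPile lam := by
  refine stack_mem_liftedPile_of_layered (fun α => ?_) fun i j j' hj hj' => ?_
  · rw [rampFill, ramp_natCast_sub]
    exact (ite_eq_or_eq _ _ _).symm
  · have hprice : price a (⟨i, j⟩ : PileBox lam) < price a (⟨i, j'⟩ : PileBox lam) := by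
      simpa [price] using hj
    exact h.greedy_rampFill n _ _ hprice (hj'.symm ▸ one_pos)

theorem SortedBy.stairPath_mem (h : SortedBy (price a) pos) {t : ℝ} (ht : 0 ≤ t) :
    stairPath pos t ∈ liftedPile lam := by
  have hu : Int.fract t ∈ Set.Icc (0 : ℝ) 1 := ⟨Int.fract_nonneg t, (Int.fract_lt_one t).le⟩
  have htn : t = ⌊t⌋₊ + Int.fract t := by
    rw [natCast_floor_eq_intCast_floor ht, Int.floor_add_fract]
  rw [htn, stairPath, rampFill_natCast_add pos _ hu, map_add, map_smul, map_smul]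
  exact convex_convexHull ℝ _ (h.stairPath_natCast_mem _) (h.stairPath_natCast_mem _)
    (sub_nonneg.2 hu.2) hu.1 (sub_add_cancel _ _)

theorem coordSum_image_liftedPile (lam : Fin d → ℕ) :
    coordSum '' liftedPile lam = Set.Icc (0 : ℝ) (∑ i, lam i : ℕ) := by
  refine Set.Subset.antisymm ?_ fun t ht => ?_
  · rintro _ ⟨p, hp, rfl⟩
    obtain ⟨y, ⟨hy0, hy1⟩, rfl⟩ := liftedPile_subset_image_stack hp
    rw [coordSum_stack]
    exact ⟨Finset.sum_nonneg fun α _ => hy0 α,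
      (Finset.sum_le_sum fun α _ => hy1 α).trans_eq (by simp)⟩
  · obtain ⟨pos, hpos⟩ := exists_sortedBy (card_pileBox lam) (price (lam := lam) 0)
    exact ⟨_, hpos.stairPath_mem ht.1, coordSum_stairPath pos ht⟩

theorem SortedBy.isSectionOf_stairPath {pos : PileBox lam ≃ Fin (∑ i, lam i)}
    (h : SortedBy (price a) pos) : IsSectionOf (liftedPile lam) coordSum (stairPath pos) := by
  rw [IsSectionOf, coordSum_image_liftedPile]
  exact ⟨(continuous_stairPath pos).continuousOn,
    fun t ht => ⟨h.stairPath_mem ht.1, coordSum_stairPath pos ht⟩⟩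

end Stair

section MonotonePath

open MeasureTheory

variable {E : Type*} [NormedAddCommGroup E] [NormedSpace ℝ E] {P : Set E} {π : E → ℝ}
  {γ σ : ℝ → E} {u v : ℝ}

theorem mem_monotonePathPolytope {y : E} :
    y ∈ monotonePathPolytope P π ↔ ∃ γ, IsSectionOf P π γ ∧ y = ⨍ t in π '' P, γ t := by
  simp only [setAverage_eq]; rfl

theorem setAverage_Icc_mono {f g : ℝ → ℝ} (hf : ContinuousOn f (Set.Icc u v))
    (hg : ContinuousOn g (Set.Icc u v)) (hle : ∀ t ∈ Set.Icc u v, f t ≤ g t) :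
    ⨍ t in Set.Icc u v, f t ≤ ⨍ t in Set.Icc u v, g t := by
  rw [setAverage_eq, setAverage_eq]
  gcongr ?_ • ?_
  exact setIntegral_mono_on hf.integrableOn_Icc hg.integrableOn_Icc measurableSet_Icc hle

theorem setAverage_Icc_eq_iff_eqOn {f g : ℝ → ℝ} (huv : u < v) (hf : ContinuousOn f (Set.Icc u v))
    (hg : ContinuousOn g (Set.Icc u v)) (hle : ∀ t ∈ Set.Icc u v, f t ≤ g t) :
    (⨍ t in Set.Icc u v, f t) = ⨍ t in Set.Icc u v, g t ↔ Set.EqOn f g (Set.Icc u v) := by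
  refine ⟨fun h t ht => (hle t ht).antisymm ?_, fun h => setAverage_congr_fun measurableSet_Icc
    (ae_of_all _ h)⟩
  by_contra! hlt
  have hint := intervalIntegral.integral_lt_integral_of_continuousOn_of_le_of_exists_lt huv hf hg
    (fun t ht => hle t (Set.Ioc_subset_Icc_self ht)) ⟨t, ht, hlt⟩
  simp only [intervalIntegral.integral_of_le huv.le, ← integral_Icc_eq_integral_Ioc] at hint
  rw [setAverage_eq, setAverage_eq] at h
  have hvol : (volume.real (Set.Icc u v))⁻¹ ≠ 0 := by
    simpa [Real.volume_real_Icc_of_le huv.le, sub_eq_zero] using huv.ne'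
  exact hint.ne (smul_right_injective ℝ hvol h)

variable [CompleteSpace E]

theorem IsSectionOf.map_average (hP : π '' P = Set.Icc u v) (hγ : IsSectionOf P π γ)
    (c : E →L[ℝ] ℝ) : c (⨍ t in π '' P, γ t) = ⨍ t in π '' P, c (γ t) := by
  have hint : IntegrableOn γ (π '' P) := hP ▸ (hP ▸ hγ.1).integrableOn_Icc
  rw [setAverage_eq, setAverage_eq, map_smul, c.integral_comp_comm hint]

theorem IsSectionOf.average_minimizes_iff (hP : π '' P = Set.Icc u v) (huv : u < v)
    {c : E →L[ℝ] ℝ} (hσ : IsSectionOf P π σ) (hmin : ∀ q ∈ P, c (σ (π q)) ≤ c q)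
    (hγ : IsSectionOf P π γ) :
    (∀ y ∈ monotonePathPolytope P π, c (⨍ t in π '' P, γ t) ≤ c y) ↔
      ∀ t ∈ π '' P, c (γ t) = c (σ t) := by
  have hcont : ∀ {τ}, IsSectionOf P π τ → ContinuousOn (fun t => c (τ t)) (Set.Icc u v) :=
    fun hτ => c.continuous.comp_continuousOn (hP ▸ hτ.1)
  have hle : ∀ {τ}, IsSectionOf P π τ → ∀ t ∈ Set.Icc u v, c (σ t) ≤ c (τ t) := fun hτ t ht => by
    obtain ⟨hmem, hπ⟩ := hτ.2 t (hP ▸ ht)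
    simpa only [hπ] using hmin _ hmem
  have hσmin : ∀ y ∈ monotonePathPolytope P π, c (⨍ t in π '' P, σ t) ≤ c y := by
    intro y hy
    obtain ⟨τ, hτ, rfl⟩ := mem_monotonePathPolytope.1 hy
    rw [hσ.map_average hP, hτ.map_average hP, hP]
    exact setAverage_Icc_mono (hcont hσ) (hcont hτ) (hle hτ)
  have hiff : c (⨍ t in π '' P, σ t) = c (⨍ t in π '' P, γ t) ↔
      ∀ t ∈ π '' P, c (γ t) = c (σ t) := by
    rw [hσ.map_average hP, hγ.map_average hP, hP,
      setAverage_Icc_eq_iff_eqOn huv (hcont hσ) (hcont hγ) (hle hγ)]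
    exact forall₂_congr fun _ _ => eq_comm
  rw [← hiff]
  exact ⟨fun h => (hσmin _ (mem_monotonePathPolytope.2 ⟨γ, hγ, rfl⟩)).antisymm
    (h _ (mem_monotonePathPolytope.2 ⟨σ, hσ, rfl⟩)), fun h y hy => h ▸ hσmin y hy⟩

end MonotonePath

section Face

variable {d : ℕ} {lam : Fin d → ℕ} {a b : Fin d → ℝ} {p q : (Fin d → ℝ) × ℝ}
  {γ : ℝ → (Fin d → ℝ) × ℝ}

/-- The face of the monotone path polytope on which the functional with coefficients `a` and `1` is
minimal. -/
def pileFace (lam : Fin d → ℕ) (a : Fin d → ℝ) : Set ((Fin d → ℝ) × ℝ) :=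
  {x | x ∈ pilePathPolytope lam ∧ ∀ y ∈ pilePathPolytope lam, pileCost a x ≤ pileCost a y}

theorem pileCost_eq_of_mem_pileFace (hp : p ∈ pileFace lam a) (hq : q ∈ pileFace lam a) :
    pileCost a p = pileCost a q :=
  (hp.2 q hq.1).antisymm (hq.2 p hp.1)

theorem IsSectionOf.average_mem_pileFace_iff (hlam : 0 < ∑ i, lam i)
    (hγ : IsSectionOf (liftedPile lam) coordSum γ) :
    (⨍ t in coordSum '' liftedPile lam, γ t) ∈ pileFace lam a ↔
      ∀ t ∈ coordSum '' liftedPile lam, PileOptimal lam a (γ t) := by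
  obtain ⟨pos, hpos⟩ := exists_sortedBy (card_pileBox lam) (price a)
  have hσ := hpos.isSectionOf_stairPath
  have hmin : ∀ q ∈ liftedPile lam, pileCost a (stairPath pos (coordSum q)) ≤ pileCost a q :=
    fun q hq => (hpos.pileOptimal_stairPath _).pileCost_le hq (hσ.2 _ ⟨q, hq, rfl⟩).2
  refine (and_iff_right (mem_monotonePathPolytope.2 ⟨γ, hγ, rfl⟩)).trans <|
    (IsSectionOf.average_minimizes_iff (c := (pileCost a).toContinuousLinearMap)
      (coordSum_image_liftedPile lam) (by exact_mod_cast hlam) hσ hmin hγ).trans <|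
    forall₂_congr fun t ht => ?_
  obtain ⟨hσmem, hσt⟩ := hσ.2 t ht
  obtain ⟨hγmem, hγt⟩ := hγ.2 t ht
  exact ((hpos.pileOptimal_stairPath t).iff_pileCost_eq hσmem hγmem (hσt.trans hγt.symm)).symm

theorem SortedBy.average_stairPath_mem_pileFace (hlam : 0 < ∑ i, lam i)
    {pos : PileBox lam ≃ Fin (∑ i, lam i)} (h : SortedBy (price a) pos) :
    (⨍ t in coordSum '' liftedPile lam, stairPath pos t) ∈ pileFace lam a :=
  (h.isSectionOf_stairPath.average_mem_pileFace_iff hlam).2 fun t _ => h.pileOptimal_stairPath t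

theorem pileFace_nonempty (hlam : 0 < ∑ i, lam i) (a : Fin d → ℝ) : (pileFace lam a).Nonempty :=
  have ⟨_, hpos⟩ := exists_sortedBy (card_pileBox lam) (price a)
  ⟨_, hpos.average_stairPath_mem_pileFace hlam⟩

theorem exists_eq_smul_pileCost (c : ((Fin d → ℝ) × ℝ) →ₗ[ℝ] ℝ) (hc : c (0, 1) ≠ 0) :
    ∃ a, c = c (0, 1) • pileCost a := by
  refine ⟨fun i => c (Pi.single i 1, 0) / c (0, 1), ?_⟩
  ext i <;> simp [pileCost_apply, mul_div_cancel₀ _ hc]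

theorem isLowerFace_iff (hlam : 0 < ∑ i, lam i) {F : Set ((Fin d → ℝ) × ℝ)} :
    IsLowerFace (pilePathPolytope lam) F ↔ ∃ a, pileFace lam a = F := by
  constructor
  · rintro ⟨-, c, hc, rfl⟩
    obtain ⟨a, ha⟩ := exists_eq_smul_pileCost c hc.ne'
    have hle : ∀ x y, c x ≤ c y ↔ pileCost a x ≤ pileCost a y := fun x y => by
      rw [ha, LinearMap.smul_apply, LinearMap.smul_apply, smul_le_smul_iff_of_pos_left hc]
    exact ⟨a, by simp only [hle, pileFace]⟩
  · rintro ⟨a, rfl⟩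
    exact ⟨pileFace_nonempty hlam a, pileCost a, by simp [pileCost_apply], rfl⟩

theorem pileFace_subset_iff (hlam : 0 < ∑ i, lam i) : pileFace lam b ⊆ pileFace lam a ↔
    ∀ α β : PileBox lam, price a α < price a β → price b α < price b β := by
  constructor
  · intro hsub α β hαβ
    by_contra! hle
    obtain ⟨pos, hpos, hlt⟩ := exists_sortedBy_lt (card_pileBox lam)
      (ne_of_apply_ne (price a) hαβ.ne') hle
    -- When `β` has just been filled, `α` is still empty, which is not optimal for `a`.
    set t : ℝ := (pos β : ℕ) + 1
    have hα : rampFill pos t α = 0 :=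
      ramp_of_nonpos (sub_nonpos.2 (by simp only [t]; exact_mod_cast hlt))
    have hβ : rampFill pos t β = 1 := ramp_of_one_le (by simp [t])
    have hσ := hpos.isSectionOf_stairPath
    have ht : t ∈ coordSum '' liftedPile lam := by
      rw [coordSum_image_liftedPile]
      exact ⟨by positivity, by simp only [t]; exact_mod_cast (pos β).2⟩
    have hopt : PileOptimal lam a (stairPath pos t) :=
      (hσ.average_mem_pileFace_iff hlam).1 (hsub (hpos.average_stairPath_mem_pileFace hlam)) t ht
    have := hopt.greedy (rampFill_mem_Icc pos t) α β hαβ (hβ ▸ one_pos)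
    exact zero_ne_one (hα.symm.trans this)
  · rintro h p hp
    obtain ⟨γ, hγ, rfl⟩ := mem_monotonePathPolytope.1 hp.1
    rw [hγ.average_mem_pileFace_iff hlam] at hp ⊢
    exact fun t ht => (hp t ht).mono h

theorem pileFace_eq_iff (hlam : 0 < ∑ i, lam i) : pileFace lam a = pileFace lam b ↔
    ∀ α β : PileBox lam, price a α < price a β ↔ price b α < price b β := by
  rw [Set.Subset.antisymm_iff, pileFace_subset_iff hlam, pileFace_subset_iff hlam]
  exact ⟨fun h α β => ⟨h.2 α β, h.1 α β⟩, fun h => ⟨fun α β => (h α β).2, fun α β => (h α β).1⟩⟩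

end Face

section Dimension

variable {d : ℕ} {lam : Fin d → ℕ} {a v : Fin d → ℝ}

/-- The directions in which `a` can be moved while keeping all equalities between prices. -/
def tieSpace {ι : Type*} (lam : ι → ℕ) (a : ι → ℝ) : Submodule ℝ (ι → ℝ) where
  carrier := {v | ∀ α β : PileBox lam, price a α = price a β → v α.1 = v β.1}
  zero_mem' _ _ _ := rfl
  add_mem' hv hw α β h := congrArg₂ (· + ·) (hv α β h) (hw α β h)
  smul_mem' c _ hv α β h := congrArg (c * ·) (hv α β h)

theorem price_add_smul {ι : Type*} {lam : ι → ℕ} (a v : ι → ℝ) (ε : ℝ) (α : PileBox lam) :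
    price (a + ε • v) α = price a α + ε * v α.1 := by
  simp only [price, Pi.add_apply, Pi.smul_apply, smul_eq_mul]; ring

theorem pileCost_add_smul (a v : Fin d → ℝ) (ε : ℝ) (p : (Fin d → ℝ) × ℝ) :
    pileCost (a + ε • v) p = pileCost a p + ε * (v ⬝ᵥ p.1) := by
  simp only [pileCost_apply, add_dotProduct, smul_dotProduct, smul_eq_mul]; ring

open Filter Topology in
theorem exists_price_add_smul_lt (a v : Fin d → ℝ) : ∃ ε > (0 : ℝ), ∀ α β : PileBox lam,
    price a α < price a β → price (a + ε • v) α < price (a + ε • v) β := by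
  have h : ∀ᶠ ε in 𝓝[>] (0 : ℝ), ∀ α β : PileBox lam,
      price a α < price a β → price (a + ε • v) α < price (a + ε • v) β := by
    simp only [eventually_all, price_add_smul]
    intro α β hαβ
    have hcont : ∀ γ : PileBox lam,
        Tendsto (fun ε : ℝ => price a γ + ε * v γ.1) (𝓝[>] 0) (𝓝 (price a γ)) := fun γ => by
      have : Continuous fun ε : ℝ => price a γ + ε * v γ.1 := by fun_prop
      simpa using (this.tendsto 0).mono_left nhdsWithin_le_nhds
    exact (hcont α).eventually_lt (hcont β) hαβ
  exact (eventually_mem_nhdsWithin.and h).exists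

theorem mem_tieSpace_iff {ε : ℝ} (hε : 0 < ε) (h : ∀ α β : PileBox lam,
    price a α < price a β → price (a + ε • v) α < price (a + ε • v) β) :
    v ∈ tieSpace lam a ↔ ∀ α β : PileBox lam,
      price (a + ε • v) α < price (a + ε • v) β → price a α < price a β := by
  constructor
  · intro hv α β hlt
    by_contra! hle
    rcases hle.lt_or_eq with h' | h'
    · exact (h β α h').not_gt hlt
    · rw [price_add_smul, price_add_smul, h', hv β α h'] at hlt
      exact hlt.false
  · intro hv α β heq
    by_contra hne
    wlog hlt : v α.1 < v β.1 generalizing α β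
    · exact this β α heq.symm (Ne.symm hne) (lt_of_le_of_ne (not_lt.1 hlt) (Ne.symm hne))
    refine (hv α β ?_).ne heq
    rw [price_add_smul, price_add_smul, heq]
    gcongr

theorem mem_tieSpace_iff_dotProduct_eq (hlam : 0 < ∑ i, lam i) : v ∈ tieSpace lam a ↔
    ∀ p ∈ pileFace lam a, ∀ q ∈ pileFace lam a, v ⬝ᵥ p.1 = v ⬝ᵥ q.1 := by
  obtain ⟨ε, hε, h⟩ := exists_price_add_smul_lt (lam := lam) a v
  rw [mem_tieSpace_iff hε h, ← pileFace_subset_iff hlam]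
  have hsub := (pileFace_subset_iff hlam).2 h
  constructor
  · intro hsup p hp q hq
    have hcost := pileCost_eq_of_mem_pileFace hp hq
    have hcost' := pileCost_eq_of_mem_pileFace (hsup hp) (hsup hq)
    simp only [pileCost_add_smul] at hcost'
    exact mul_left_cancel₀ hε.ne' (by linarith)
  · intro hv p hp
    obtain ⟨q, hq⟩ := pileFace_nonempty hlam (a + ε • v)
    refine ⟨hp.1, fun y hy => le_trans (le_of_eq ?_) (hq.2 y hy)⟩
    rw [pileCost_add_smul, pileCost_add_smul, hv p hp q (hsub hq),
      pileCost_eq_of_mem_pileFace hp (hsub hq)]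

theorem vectorSpan_le_ker_iff {E : Type*} [AddCommGroup E] [Module ℝ E] {F : Set E}
    {f : E →ₗ[ℝ] ℝ} : vectorSpan ℝ F ≤ f.ker ↔ ∀ p ∈ F, ∀ q ∈ F, f p = f q := by
  simp only [vectorSpan_def, Submodule.span_le, Set.vsub_subset_iff, vsub_eq_sub, SetLike.mem_coe,
    LinearMap.mem_ker, map_sub, sub_eq_zero]

theorem finrank_map_fst_of_le_ker_pileCost {W : Submodule ℝ ((Fin d → ℝ) × ℝ)}
    (hW : W ≤ (pileCost a).ker) :
    Module.finrank ℝ (W.map (LinearMap.fst ℝ (Fin d → ℝ) ℝ)) = Module.finrank ℝ W := by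
  have hinj : Function.Injective ((LinearMap.fst ℝ (Fin d → ℝ) ℝ).domRestrict W) := by
    rw [injective_iff_map_eq_zero]
    rintro ⟨w, hw⟩ (h0 : w.1 = 0)
    have hcost : pileCost a w = 0 := hW hw
    rw [pileCost_apply, h0, dotProduct_zero, zero_add] at hcost
    exact Subtype.ext (Prod.ext h0 hcost)
  rw [← LinearMap.finrank_range_of_inj hinj, LinearMap.range_domRestrict]

theorem finrank_add_finrank_eq_of_mem_iff_dotProduct_eq_zero {n : ℕ}
    {W T : Submodule ℝ (Fin n → ℝ)} (hT : ∀ v, v ∈ T ↔ ∀ w ∈ W, v ⬝ᵥ w = 0) :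
    Module.finrank ℝ W + Module.finrank ℝ T = n := by
  let B : LinearMap.BilinForm ℝ (Fin n → ℝ) := dotProductBilin ℝ ℝ
  have hB : B.Nondegenerate :=
    ⟨fun v hv => dotProduct_self_eq_zero.1 (hv v), fun v hv => dotProduct_self_eq_zero.1 (hv v)⟩
  have horth : B.orthogonal W = T := by
    ext v
    simp only [LinearMap.BilinForm.mem_orthogonal_iff, hT, dotProduct_comm v]
    rfl
  have hle := Submodule.finrank_le W
  have hsub := LinearMap.BilinForm.finrank_orthogonal hB W
  rw [Module.finrank_fin_fun] at hle hsub
  rw [← horth, hsub, Nat.add_sub_cancel' hle]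

theorem faceDim_pileFace_add_finrank_tieSpace (hlam : 0 < ∑ i, lam i) (a : Fin d → ℝ) :
    faceDim (pileFace lam a) + Module.finrank ℝ (tieSpace lam a) = d := by
  have hker : vectorSpan ℝ (pileFace lam a) ≤ (pileCost a).ker :=
    vectorSpan_le_ker_iff.2 fun p hp q hq => pileCost_eq_of_mem_pileFace hp hq
  rw [faceDim, ← finrank_map_fst_of_le_ker_pileCost hker]
  refine finrank_add_finrank_eq_of_mem_iff_dotProduct_eq_zero fun v => ?_
  rw [mem_tieSpace_iff_dotProduct_eq hlam]
  exact (vectorSpan_le_ker_iff (f := dotProductBilin ℝ ℝ v ∘ₗ LinearMap.fst ℝ _ ℝ)).symm.trans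
    (Set.forall_mem_image (f := Prod.fst) (p := fun w => v ⬝ᵥ w = 0)).symm

end Dimension

section MapsWithImage

open Finset

variable {α : Type*} [Fintype α] [DecidableEq α] {d : ℕ}

/-- The maps `Fin d → α` with image exactly `T`. -/
def mapsWithImage (d : ℕ) (T : Finset α) : Finset (Fin d → α) := {f | univ.image f = T}

theorem mem_mapsWithImage {T : Finset α} {f : Fin d → α} :
    f ∈ mapsWithImage d T ↔ univ.image f = T := by
  simp [mapsWithImage]

theorem mem_mapsWithImage_univ {f : Fin d → α} :
    f ∈ mapsWithImage d univ ↔ Function.Surjective f := by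
  rw [mem_mapsWithImage, eq_univ_iff_forall, Function.Surjective]
  simp

theorem cons_mem_mapsWithImage {T : Finset α} {x : α} (hx : x ∈ T) {g : Fin d → α} :
    Fin.cons x g ∈ mapsWithImage (d + 1) T ↔
      g ∈ mapsWithImage d T ∪ mapsWithImage d (T.erase x) := by
  have himage : univ.image (Fin.cons x g : Fin (d + 1) → α) = insert x (univ.image g) := by
    ext y; simp [Fin.exists_fin_succ, eq_comm]
  rw [mem_union, mem_mapsWithImage, mem_mapsWithImage, mem_mapsWithImage, himage]
  grind

theorem card_mapsWithImage_filter_zero {T : Finset α} {x : α} (hx : x ∈ T) :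
    #{f ∈ mapsWithImage (d + 1) T | f 0 = x} =
      #(mapsWithImage d T) + #(mapsWithImage d (T.erase x)) := by
  have hdisj : Disjoint (mapsWithImage d T) (mapsWithImage d (T.erase x)) := by
    rw [disjoint_left]
    intro f hf hf'
    rw [mem_mapsWithImage] at hf hf'
    exact notMem_erase x T (hf' ▸ hf ▸ hx)
  rw [← card_union_of_disjoint hdisj]
  refine card_nbij' Fin.tail (fun g => Fin.cons x g) ?_ ?_ ?_ ?_
  · rintro f hf
    obtain ⟨hf, rfl⟩ := mem_filter.1 hf
    rwa [mem_coe, ← cons_mem_mapsWithImage hx, Fin.cons_self_tail]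
  · exact fun g hg => mem_filter.2 ⟨(cons_mem_mapsWithImage hx).2 hg, rfl⟩
  · rintro f hf
    obtain ⟨-, rfl⟩ := mem_filter.1 hf
    exact Fin.cons_self_tail f
  · exact fun g _ => Fin.tail_cons (α := fun _ => α) x g

theorem card_mapsWithImage_succ (d : ℕ) (T : Finset α) :
    #(mapsWithImage (d + 1) T) =
      ∑ x ∈ T, (#(mapsWithImage d T) + #(mapsWithImage d (T.erase x))) := by
  rw [card_eq_sum_card_fiberwise (f := fun f : Fin (d + 1) → α => f 0) (t := T)]
  · exact sum_congr rfl fun x hx => card_mapsWithImage_filter_zero hx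
  · intro f hf
    exact mem_mapsWithImage.1 hf ▸ mem_image_of_mem f (mem_univ 0)

theorem card_mapsWithImage (d : ℕ) (T : Finset α) :
    #(mapsWithImage d T) = (#T)! * Nat.stirlingSecond d #T := by
  induction d generalizing T with
  | zero =>
    rcases T.eq_empty_or_nonempty with rfl | hT
    · simp [mapsWithImage]
    · obtain ⟨m, hm⟩ := Nat.exists_eq_succ_of_ne_zero hT.card_pos.ne'
      simp [mapsWithImage, hm, hT.ne_empty.symm, filter_false]
  | succ d ih =>
    rw [card_mapsWithImage_succ]
    rcases hT : #T with _ | m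
    · simp [card_eq_zero.1 hT]
    · have hterm : ∀ x ∈ T, #(mapsWithImage d T) + #(mapsWithImage d (T.erase x)) =
          (m + 1)! * Nat.stirlingSecond d (m + 1) + m ! * Nat.stirlingSecond d m := fun x hx => by
        rw [ih, ih, card_erase_of_mem hx, hT, Nat.add_sub_cancel]
      rw [sum_congr rfl hterm, sum_const, hT, smul_eq_mul, Nat.stirlingSecond_succ_succ,
        Nat.factorial_succ]
      ring

end MapsWithImage

section ShiftCode

open Finset

variable {n ℓ : ℕ}

/-- The conditions that characterize the shift codes of increasing sequences `b` of length `n`, see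
`shiftCode`. The entry `c j` consists of the number of shifted terms `b i + 2` not exceeding `b j`
and of a mark, which is set if one of them is equal to `b j`. -/
structure IsShiftCode (c : Fin n → ℕ × Bool) : Prop where
  le (j : Fin n) : (c j).1 ≤ j
  mono (i j : Fin n) : i < j → (c i).1 ≤ (c j).1
  pos (j : Fin n) : (c j).2 → 0 < (c j).1
  lt (i j : Fin n) : i < j → (c j).2 → (c i).1 < (c j).1

theorem isShiftCode_snoc {c : Fin n → ℕ × Bool} {x : ℕ × Bool} :
    IsShiftCode (Fin.snoc c x : Fin (n + 1) → ℕ × Bool) ↔ IsShiftCode c ∧ x.1 ≤ n ∧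
      (∀ i, (c i).1 ≤ x.1) ∧ (x.2 → 0 < x.1 ∧ ∀ i, (c i).1 < x.1) := by
  constructor
  · rintro ⟨h1, h2, h3, h4⟩
    simp only [Fin.forall_fin_succ', Fin.snoc_castSucc, Fin.snoc_last, Fin.val_castSucc,
      Fin.val_last, Fin.castSucc_lt_castSucc_iff, Fin.castSucc_lt_last, true_imp_iff,
      forall_and] at h1 h2 h3 h4
    exact ⟨⟨h1.1, h2.1.1, h3.1, h4.1.1⟩, h1.2, h2.2.1, fun hx => ⟨h3.2 hx, fun i => h4.2.1 i hx⟩⟩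
  · rintro ⟨⟨h1, h2, h3, h4⟩, h5, h6, h7⟩
    constructor <;>
      simp only [Fin.forall_fin_succ', Fin.snoc_castSucc, Fin.snoc_last, Fin.val_castSucc,
        Fin.val_last, Fin.castSucc_lt_castSucc_iff, Fin.castSucc_lt_last, true_imp_iff, forall_and,
        (Fin.castSucc_lt_last _).not_gt, lt_irrefl, false_imp_iff, implies_true, and_true]
    · exact ⟨h1, h5⟩
    · exact ⟨h2, h6⟩
    · exact ⟨h3, fun hx => (h7 hx).1⟩
    · exact ⟨h4, fun i hx => (h7 hx).2 i⟩

/-- The number of marked entries of a shift code. -/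
def markCount (c : Fin n → ℕ × Bool) : ℕ := #{j | (c j).2}

theorem markCount_snoc (c : Fin n → ℕ × Bool) (x : ℕ × Bool) :
    markCount (Fin.snoc c x : Fin (n + 1) → ℕ × Bool) = markCount c + x.2.toNat := by
  simp only [markCount, card_filter, Fin.sum_univ_castSucc, Fin.snoc_castSucc, Fin.snoc_last]
  cases x.2 <;> rfl

open Classical in
/-- The shift codes of length `n` whose entries are at most `ℓ`, the bound being the parameter of
the recursion by which they are counted. -/
noncomputable def shiftCodes (n ℓ : ℕ) : Finset (Fin n → ℕ × Bool) :=
  {c ∈ Fintype.piFinset fun _ => range (n + 1) ×ˢ univ | IsShiftCode c ∧ ∀ j, (c j).1 ≤ ℓ}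

theorem mem_shiftCodes {c : Fin n → ℕ × Bool} :
    c ∈ shiftCodes n ℓ ↔ IsShiftCode c ∧ ∀ j, (c j).1 ≤ ℓ := by
  classical
  refine mem_filter.trans (and_iff_right_of_imp fun h => ?_)
  simp only [Fintype.mem_piFinset, mem_product, mem_range, mem_univ, and_true]
  exact fun j => (h.1.le j).trans_lt (by lia)

theorem mem_shiftCodes_self {c : Fin n → ℕ × Bool} : c ∈ shiftCodes n n ↔ IsShiftCode c :=
  mem_shiftCodes.trans (and_iff_left_of_imp fun h j => (h.le j).trans j.2.le)

theorem shiftCodes_succ_self (n : ℕ) : shiftCodes (n + 1) (n + 1) = shiftCodes (n + 1) n := by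
  ext c
  rw [mem_shiftCodes_self, mem_shiftCodes, iff_self_and]
  exact fun h j => (h.le j).trans (Nat.lt_succ_iff.1 j.2)

theorem shiftCodes_zero (n : ℕ) : shiftCodes n 0 = {fun _ => (0, false)} := by
  ext c
  rw [mem_shiftCodes, mem_singleton]
  constructor
  · rintro ⟨hc, h0⟩
    funext j
    have hj : (c j).1 = 0 := Nat.le_zero.1 (h0 j)
    exact Prod.ext hj (Bool.eq_false_iff.2 fun hmark => (hc.pos j hmark).ne' hj)
  · rintro rfl
    exact ⟨⟨by simp, by simp, by simp, by simp⟩, by simp⟩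

theorem snoc_mem_shiftCodes_succ {c : Fin n → ℕ × Bool} {x : ℕ × Bool} :
    (Fin.snoc c x : Fin (n + 1) → ℕ × Bool) ∈ shiftCodes (n + 1) (ℓ + 1) ↔
      (Fin.snoc c x : Fin (n + 1) → ℕ × Bool) ∈ shiftCodes (n + 1) ℓ ∨
      ℓ + 1 ≤ n ∧ (x = (ℓ + 1, false) ∧ c ∈ shiftCodes n (ℓ + 1) ∨
        x = (ℓ + 1, true) ∧ c ∈ shiftCodes n ℓ) := by
  obtain ⟨x, _ | _⟩ := x <;>
    simp only [mem_shiftCodes, isShiftCode_snoc, Fin.forall_fin_succ', Fin.snoc_castSucc,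
      Fin.snoc_last] <;> grind

theorem card_shiftCodes_succ (hℓ : ℓ + 1 ≤ n) (m : ℕ) :
    #{c ∈ shiftCodes (n + 1) (ℓ + 1) | markCount c = m} =
      #{c ∈ shiftCodes (n + 1) ℓ | markCount c = m} +
        #{c ∈ shiftCodes n (ℓ + 1) | markCount c = m} +
        #{c ∈ shiftCodes n ℓ | markCount c + 1 = m} := by
  have hinj : ∀ x, Function.Injective fun c : Fin n → ℕ × Bool =>
      (Fin.snoc c x : Fin (n + 1) → ℕ × Bool) := fun x =>
    Fin.snoc_left_injective (α := fun _ => ℕ × Bool) x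
  have hunion : {c ∈ shiftCodes (n + 1) (ℓ + 1) | markCount c = m} =
      {c ∈ shiftCodes (n + 1) ℓ | markCount c = m} ∪
        image (Fin.snoc · (ℓ + 1, false)) {c ∈ shiftCodes n (ℓ + 1) | markCount c = m} ∪
        image (Fin.snoc · (ℓ + 1, true)) {c ∈ shiftCodes n ℓ | markCount c + 1 = m} := by
    ext c
    induction c using Fin.snocCases with
    | snoc c x =>
      simp only [mem_filter, mem_union, mem_image, Fin.snoc_inj, snoc_mem_shiftCodes_succ,
        markCount_snoc]
      grind
  have hlast : ∀ c ∈ shiftCodes (n + 1) ℓ, (c (Fin.last n)).1 ≤ ℓ :=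
    fun c hc => (mem_shiftCodes.1 hc).2 _
  rw [hunion, card_union_of_disjoint, card_union_of_disjoint, card_image_of_injective _ (hinj _),
    card_image_of_injective _ (hinj _)]
  · simp only [disjoint_left, mem_filter, mem_image, not_exists, not_and]
    rintro _ ⟨hc, -⟩ c - rfl
    simpa using hlast _ hc
  · simp only [disjoint_left, mem_filter, mem_union, mem_image, not_exists, not_and]
    rintro _ (⟨hc, -⟩ | ⟨c, -, rfl⟩) c' - hsnoc
    · rw [← hsnoc] at hc
      simpa using hlast _ hc
    · simpa using (Fin.snoc_inj.1 hsnoc).2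

/-- The number of shift codes of length `n + 1` with entries at most `ℓ` and `m` marks, for
`ℓ ≤ n + 1`. The truncated subtractions are harmless, since for `n + 1 < m` the factors in front
vanish. -/
def shiftCodeCount (n ℓ m : ℕ) : ℤ :=
  n.choose m * (n + 1 + ℓ - m).choose (n + 1) - (n + 1).choose m * (n + 1 + ℓ - m).choose (n + 2)

theorem shiftCodeCount_zero_middle (n m : ℕ) : shiftCodeCount n 0 m = if m = 0 then 1 else 0 := by
  rcases m with _ | m
  · simp [shiftCodeCount]
  · simp [shiftCodeCount, Nat.choose_eq_zero_of_lt (show n - m < n + 1 by lia),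
      Nat.choose_eq_zero_of_lt (show n - m < n + 2 by lia)]

theorem shiftCodeCount_succ_self (n m : ℕ) : shiftCodeCount n (n + 1) m = shiftCodeCount n n m := by
  have hpascal : n.choose m * (2 * n + 1 - m).choose n =
      (n + 1).choose m * (2 * n + 1 - m).choose (n + 1) := by
    have h1 := Nat.choose_succ_right_eq (2 * n + 1 - m) n
    have h2 := Nat.choose_mul_succ_eq n m
    rw [show 2 * n + 1 - m - n = n + 1 - m by lia] at h1
    refine Nat.eq_of_mul_eq_mul_right (Nat.add_one_pos n) ?_
    calc _ = (n.choose m * (n + 1)) * (2 * n + 1 - m).choose n := by ring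
      _ = (n + 1).choose m * ((2 * n + 1 - m).choose n * (n + 1 - m)) := by rw [h2]; ring
      _ = _ := by rw [← h1]; ring
  rcases le_or_gt m (2 * n + 1) with hm | hm
  · rw [shiftCodeCount, shiftCodeCount, show n + 1 + (n + 1) - m = 2 * n + 1 - m + 1 by lia,
      show n + 1 + n - m = 2 * n + 1 - m by lia, Nat.choose_succ_succ' _ n,
      Nat.choose_succ_succ' _ (n + 1)]
    push_cast
    linear_combination (mod_cast hpascal : (n.choose m * (2 * n + 1 - m).choose n : ℤ) =
      (n + 1).choose m * (2 * n + 1 - m).choose (n + 1))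
  · simp [shiftCodeCount, Nat.choose_eq_zero_of_lt (show n < m by lia),
      Nat.choose_eq_zero_of_lt (show n + 1 < m by lia)]

theorem shiftCodeCount_succ_succ_zero (n ℓ : ℕ) :
    shiftCodeCount (n + 1) (ℓ + 1) 0 = shiftCodeCount (n + 1) ℓ 0 + shiftCodeCount n (ℓ + 1) 0 := by
  simp only [shiftCodeCount, Nat.choose_zero_right, Nat.sub_zero]
  rw [show n + 1 + 1 + (ℓ + 1) = n + ℓ + 2 + 1 by ring, show n + 1 + 1 + ℓ = n + ℓ + 2 by ring,
    show n + 1 + (ℓ + 1) = n + ℓ + 2 by ring, Nat.choose_succ_succ' _ (n + 1),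
    Nat.choose_succ_succ' _ (n + 2)]
  push_cast
  ring

theorem shiftCodeCount_succ_succ_succ (n ℓ m : ℕ) :
    shiftCodeCount (n + 1) (ℓ + 1) (m + 1) = shiftCodeCount (n + 1) ℓ (m + 1) +
      shiftCodeCount n (ℓ + 1) (m + 1) + shiftCodeCount n ℓ m := by
  rcases le_or_gt m (n + 1 + ℓ) with hm | hm
  · simp only [shiftCodeCount]
    rw [show n + 1 + 1 + (ℓ + 1) - (m + 1) = n + 1 + ℓ - m + 1 by lia,
      show n + 1 + 1 + ℓ - (m + 1) = n + 1 + ℓ - m by lia,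
      show n + 1 + (ℓ + 1) - (m + 1) = n + 1 + ℓ - m by lia, Nat.choose_succ_succ' _ (n + 1),
      Nat.choose_succ_succ' _ (n + 2), Nat.choose_succ_succ' (n + 1) m, Nat.choose_succ_succ' n m]
    push_cast
    ring
  · simp [shiftCodeCount, Nat.choose_eq_zero_of_lt (show n < m by lia),
      Nat.choose_eq_zero_of_lt (show n + 1 < m by lia),
      Nat.choose_eq_zero_of_lt (show n < m + 1 by lia),
      Nat.choose_eq_zero_of_lt (show n + 1 < m + 1 by lia),
      Nat.choose_eq_zero_of_lt (show n + 1 + 1 < m + 1 by lia)]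

theorem card_shiftCodes_zero (n m : ℕ) :
    #{c ∈ shiftCodes n 0 | markCount c = m} = if m = 0 then 1 else 0 := by
  have hmark : markCount (fun _ : Fin n => (0, false)) = 0 := by simp [markCount]
  rcases m with _ | m <;> simp [shiftCodes_zero, filter_singleton, hmark]

theorem card_shiftCodes (hℓ : ℓ ≤ n + 1) (m : ℕ) :
    (#{c ∈ shiftCodes (n + 1) ℓ | markCount c = m} : ℤ) = shiftCodeCount n ℓ m := by
  induction n generalizing ℓ m with
  | zero =>
    have h0 : (#{c ∈ shiftCodes 1 0 | markCount c = m} : ℤ) = shiftCodeCount 0 0 m := by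
      simp [card_shiftCodes_zero, shiftCodeCount_zero_middle]
    interval_cases ℓ
    · exact h0
    · rw [shiftCodes_succ_self, shiftCodeCount_succ_self, h0]
  | succ n ihn =>
    induction ℓ generalizing m with
    | zero => simp [card_shiftCodes_zero, shiftCodeCount_zero_middle]
    | succ ℓ ih =>
      rcases hℓ.eq_or_lt with heq | hlt
      · obtain rfl : ℓ = n + 1 := by lia
        rw [shiftCodes_succ_self, shiftCodeCount_succ_self, ih (by lia)]
      · rw [card_shiftCodes_succ (by lia)]
        push_cast
        rw [ih (by lia), ihn (by lia)]
        rcases m with _ | m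
        · simp [shiftCodeCount_succ_succ_zero]
        · simp only [Nat.add_right_cancel_iff]
          rw [ihn (by lia), shiftCodeCount_succ_succ_succ]

theorem succ_mul_shiftCodeCount_succ {r k : ℕ} (hk : k ≤ r) :
    (r + 1) * shiftCodeCount r (r + 1) (r - k) =
      (r + 1).choose (k + 1) * (r + 2 + k).choose k := by
  have hr : (r + 1) * (r.choose k : ℤ) = (r + 1).choose (k + 1) * (k + 1) := by
    exact_mod_cast Nat.add_one_mul_choose_eq r k
  have hM : ((r + 2 + k).choose (k + 1) : ℤ) * (k + 1) = (r + 2 + k).choose k * (r + 2) := by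
    exact_mod_cast (Nat.choose_succ_right_eq (r + 2 + k) k).trans (by rw [Nat.add_sub_cancel])
  rw [shiftCodeCount, show r + 1 + (r + 1) - (r - k) = r + 2 + k by lia,
    Nat.choose_symm hk, Nat.choose_symm_of_eq_add (show r + 1 = r - k + (k + 1) by lia),
    Nat.choose_symm_of_eq_add (show r + 2 + k = r + 1 + (k + 1) by lia), Nat.choose_symm_add]
  linear_combination (r + 2 + k).choose (k + 1) * hr + (r + 1).choose (k + 1) * hM

/-- The number of codes counted here is the Kirkman–Cayley number of dissections of an `(r + 2)`-gon
into `k` polygons. -/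
theorem mul_card_shiftCodes_self {r k : ℕ} (hk : 1 ≤ k) (hkr : k ≤ r) :
    r * #{c ∈ shiftCodes r r | markCount c + k = r} = r.choose k * (r + k).choose (k - 1) := by
  obtain ⟨k, rfl⟩ := Nat.exists_eq_add_of_le' hk
  obtain ⟨r, rfl⟩ := Nat.exists_eq_add_of_le' (hk.trans hkr)
  have hmark : ∀ c : Fin (r + 1) → ℕ × Bool,
      markCount c + (k + 1) = r + 1 ↔ markCount c = r - k := fun c => by lia
  have hcount := succ_mul_shiftCodeCount_succ (show k ≤ r by lia)
  rw [← card_shiftCodes le_rfl] at hcount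
  simp only [hmark]
  rw [Nat.add_sub_cancel, show r + 1 + (k + 1) = r + 2 + k by ring]
  exact_mod_cast hcount

end ShiftCode

section ShiftOrder

open Finset

variable {ι κ : Type*} {n d : ℕ}

/-- Two families of reals have the same shift order if the points `a i` and `a i + 2` of the first
are ordered in the same way as those of the second. For `λ = (2, …, 2)` these are, up to a common
translation by `1`, the prices of the boxes. -/
def SameShiftOrder (a b : ι → ℝ) : Prop :=
  ∀ i j, (a i < a j ↔ b i < b j) ∧ (a i + 2 < a j ↔ b i + 2 < b j) ∧
    (a i + 2 ≤ a j ↔ b i + 2 ≤ b j)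

theorem sameShiftOrder_iff_price {a b : ι → ℝ} : SameShiftOrder a b ↔
    ∀ α β : PileBox (fun _ : ι => 2), price a α < price a β ↔ price b α < price b β := by
  simp only [price, Sigma.forall, Fin.forall_fin_two, Fin.val_zero, Fin.val_one, Nat.cast_zero,
    Nat.cast_one, mul_zero, add_zero, mul_one, ← add_assoc, add_lt_add_iff_right]
  constructor
  · intro h i
    exact ⟨fun j => ⟨(h i j).1, by simpa only [not_le] using not_congr (h j i).2.2⟩,
      fun j => ⟨(h i j).2.1, (h i j).1⟩⟩
  · intro h i j
    exact ⟨((h i).1 j).1, ((h i).2 j).1, by simpa only [not_lt] using not_congr ((h j).1 i).2⟩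

theorem sameShiftOrder_comp {f : κ → ι} (hf : f.Surjective) {a b : ι → ℝ} :
    SameShiftOrder (a ∘ f) (b ∘ f) ↔ SameShiftOrder a b := by
  simp only [SameShiftOrder, hf.forall₂, Function.comp_apply]

theorem exists_strictMono_comp_surjective (a : Fin d → ℝ) :
    ∃ (r : ℕ) (f : Fin d → Fin r) (b : Fin r → ℝ), f.Surjective ∧ StrictMono b ∧ b ∘ f = a := by
  let e := (univ.image a).orderIsoOfFin rfl
  let g : Fin d → univ.image a := fun i => ⟨a i, mem_image_of_mem a (mem_univ i)⟩
  have hg : g.Surjective := by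
    rintro ⟨x, hx⟩
    obtain ⟨i, -, rfl⟩ := mem_image.1 hx
    exact ⟨i, rfl⟩
  exact ⟨_, e.symm ∘ g, fun j => e j, e.symm.surjective.comp hg,
    (Subtype.strictMono_coe _).comp e.strictMono, funext fun i => by simp [g]⟩

theorem sigma_eq_of_lt_iff_lt {r r' : ℕ} {f : Fin d → Fin r} {f' : Fin d → Fin r'}
    (hf : f.Surjective) (hf' : f'.Surjective) (h : ∀ i j, f i < f j ↔ f' i < f' j) :
    (⟨r, f⟩ : Σ r, Fin d → Fin r) = ⟨r', f'⟩ := by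
  have heq : ∀ i j, f i = f j ↔ f' i = f' j := fun i j => by
    simp only [le_antisymm_iff, ← not_lt, h]
  have hsurj : ∀ i, f (Function.surjInv hf (f i)) = f i := fun i => Function.surjInv_eq hf _
  have hg : (f' ∘ Function.surjInv hf).Surjective := fun j => by
    obtain ⟨i, rfl⟩ := hf' j
    exact ⟨f i, (heq _ _).1 (hsurj i)⟩
  have hmono : StrictMono (f' ∘ Function.surjInv hf) := fun i j hij => by
    rwa [Function.comp_apply, Function.comp_apply, ← h, Function.surjInv_eq hf,
      Function.surjInv_eq hf]
  obtain rfl : r = r' :=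
    (Fin.le_of_injective _ hmono.injective).antisymm (Fin.le_of_surjective _ hg)
  have hid : f' ∘ Function.surjInv hf = id :=
    (hmono.range_inj strictMono_id).1 (hg.range_eq.trans Set.range_id.symm)
  exact congrArg _ (funext fun i => (congrFun hid (f i)).symm.trans ((heq _ _).1 (hsurj i)))

theorem lt_card_iff_mem_of_isLowerSet {s : Finset (Fin n)} (hs : IsLowerSet (s : Set (Fin n)))
    {i : Fin n} : (i : ℕ) < #s ↔ i ∈ s := by
  constructor
  · intro hi
    by_contra hmem
    refine hi.not_ge ((card_le_card fun j hj => mem_Iio.2 ?_).trans (Fin.card_Iio i).le)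
    exact lt_of_not_ge fun hij => hmem (hs hij hj)
  · intro hi
    exact (Fin.card_Iic i).ge.trans (card_le_card fun j hj => hs (mem_Iic.1 hj) hi)

open Classical in
/-- The shift code of an increasing sequence: for every term `b j`, the number of shifted terms
`b i + 2` not exceeding it, and a mark recording whether it is equal to one of them. -/
noncomputable def shiftCode (b : Fin n → ℝ) (j : Fin n) : ℕ × Bool :=
  (#{i | b i + 2 ≤ b j}, decide (∃ i, b i + 2 = b j))

theorem shiftCode_snd {b : Fin n → ℝ} {j : Fin n} : (shiftCode b j).2 ↔ ∃ i, b i + 2 = b j :=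
  decide_eq_true_iff

theorem lt_shiftCode_fst {b : Fin n → ℝ} (hb : StrictMono b) {i j : Fin n} :
    (i : ℕ) < (shiftCode b j).1 ↔ b i + 2 ≤ b j := by
  classical
  refine (lt_card_iff_mem_of_isLowerSet fun i i' hi h => ?_).trans (mem_filter_univ _)
  rw [mem_coe, mem_filter_univ] at h ⊢
  exact (add_le_add_left (hb.monotone hi) 2).trans h

theorem shiftCode_fst_of_add_eq {b : Fin n → ℝ} (hb : StrictMono b) {i j : Fin n}
    (h : b i + 2 = b j) : (shiftCode b j).1 = i + 1 := by
  simp only [shiftCode, ← h, add_le_add_iff_right, hb.le_iff_le]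
  rw [← Fin.card_Iic]
  congr 1
  ext; simp

theorem add_eq_iff_shiftCode {b : Fin n → ℝ} (hb : StrictMono b) {i j : Fin n} :
    b i + 2 = b j ↔ (shiftCode b j).2 ∧ (shiftCode b j).1 = i + 1 := by
  refine ⟨fun h => ⟨shiftCode_snd.2 ⟨i, h⟩, shiftCode_fst_of_add_eq hb h⟩, ?_⟩
  rintro ⟨hmark, hi⟩
  obtain ⟨i', hi'⟩ := shiftCode_snd.1 hmark
  rw [shiftCode_fst_of_add_eq hb hi', Nat.add_right_cancel_iff, Fin.val_inj] at hi
  exact hi ▸ hi'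

theorem isShiftCode_shiftCode {b : Fin n → ℝ} (hb : StrictMono b) : IsShiftCode (shiftCode b) where
  le j := not_lt.1 fun h => by linarith [(lt_shiftCode_fst hb).1 h]
  mono i j hij := by
    simp only [shiftCode]
    refine card_le_card fun p hp => ?_
    rw [mem_filter_univ] at hp ⊢
    exact hp.trans (hb hij).le
  pos j hj := by
    obtain ⟨p, hp⟩ := shiftCode_snd.1 hj
    rw [shiftCode_fst_of_add_eq hb hp]
    exact Nat.succ_pos _
  lt i j hij hj := by
    obtain ⟨p, hp⟩ := shiftCode_snd.1 hj
    rw [shiftCode_fst_of_add_eq hb hp, Nat.lt_succ_iff, ← not_lt, lt_shiftCode_fst hb, hp, not_le]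
    exact hb hij

theorem sameShiftOrder_iff_shiftCode {b b' : Fin n → ℝ} (hb : StrictMono b) (hb' : StrictMono b') :
    SameShiftOrder b b' ↔ shiftCode b = shiftCode b' := by
  constructor
  · intro h
    funext j
    have heq : ∀ i, b i + 2 = b j ↔ b' i + 2 = b' j := fun i => by
      rw [eq_iff_le_not_lt, eq_iff_le_not_lt, (h i j).2.1, (h i j).2.2]
    simp only [shiftCode, heq, (h _ j).2.2]
  · intro h i j
    have hle : b i + 2 ≤ b j ↔ b' i + 2 ≤ b' j := by
      rw [← lt_shiftCode_fst hb, ← lt_shiftCode_fst hb', h]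
    have heq : b i + 2 = b j ↔ b' i + 2 = b' j := by
      rw [add_eq_iff_shiftCode hb, add_eq_iff_shiftCode hb', h]
    refine ⟨by rw [hb.lt_iff_lt, hb'.lt_iff_lt], ?_, hle⟩
    rw [lt_iff_le_and_ne, lt_iff_le_and_ne, hle, Ne, Ne, heq]

theorem sigma_shiftCode_eq_iff {r r' : ℕ} {f : Fin d → Fin r} {f' : Fin d → Fin r'}
    {b : Fin r → ℝ} {b' : Fin r' → ℝ} (hf : f.Surjective) (hf' : f'.Surjective)
    (hb : StrictMono b) (hb' : StrictMono b') :
    (⟨r, f, shiftCode b⟩ : Σ r, (Fin d → Fin r) × (Fin r → ℕ × Bool)) = ⟨r', f', shiftCode b'⟩ ↔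
      SameShiftOrder (b ∘ f) (b' ∘ f') := by
  constructor
  · intro h
    obtain rfl : r = r' := congrArg Sigma.fst h
    simp only [Sigma.mk.injEq, heq_eq_eq, true_and, Prod.mk.injEq] at h
    obtain ⟨rfl, hcode⟩ := h
    rwa [sameShiftOrder_comp hf, sameShiftOrder_iff_shiftCode hb hb']
  · intro h
    have hlt : ∀ i j, f i < f j ↔ f' i < f' j := fun i j => by
      simpa [hb.lt_iff_lt, hb'.lt_iff_lt] using (h i j).1
    obtain ⟨rfl, rfl⟩ := Sigma.mk.inj_iff.1 (sigma_eq_of_lt_iff_lt hf hf' hlt)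
    rw [sameShiftOrder_comp hf, sameShiftOrder_iff_shiftCode hb hb'] at h
    rw [h]

end ShiftOrder

section Realization

open Finset

variable {n : ℕ}

theorem exists_next_term {b : Fin n → ℝ} (hb : StrictMono b) {x : ℕ × Bool} (hx : x.1 ≤ n)
    (hle : ∀ i, (shiftCode b i).1 ≤ x.1)
    (hmark : x.2 → 0 < x.1 ∧ ∀ i, (shiftCode b i).1 < x.1) :
    ∃ y, (∀ i, b i < y) ∧ (∀ i : Fin n, (i : ℕ) < x.1 ↔ b i + 2 ≤ y) ∧
      (x.2 ↔ ∃ i, b i + 2 = y) := by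
  have hlt : ∀ i p : Fin n, (shiftCode b i).1 ≤ p → b i < b p + 2 := fun i p h =>
    lt_of_not_ge fun h' => ((lt_shiftCode_fst hb).2 h').not_ge h
  obtain ⟨q, _ | _⟩ := x
  · obtain ⟨y, hlo, hhi⟩ := Order.exists_between_finsets
      (univ.image b ∪ image (b · + 2) {i : Fin n | (i : ℕ) < q})
      (image (b · + 2) {i : Fin n | q ≤ i})
      (by
        simp only [mem_union, mem_image, mem_filter_univ, mem_univ, true_and]
        rintro _ (⟨i, rfl⟩ | ⟨i, hi, rfl⟩) _ ⟨p, hp, rfl⟩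
        · exact hlt i p ((hle i).trans hp)
        · exact add_lt_add_left (hb (Fin.lt_def.2 (hi.trans_le hp))) 2)
    simp only [forall_mem_union, forall_mem_image, mem_filter_univ, mem_univ, true_imp_iff]
      at hlo hhi
    refine ⟨y, hlo.1, fun i => ⟨fun h => (hlo.2 h).le, fun h => ?_⟩, ?_⟩
    · exact lt_of_not_ge fun hqi => (hhi hqi).not_ge h
    · simp only [Bool.false_eq_true, false_iff, not_exists]
      exact fun i => (lt_or_ge (i : ℕ) q).elim (fun h => (hlo.2 h).ne) (fun h => (hhi h).ne')
  · obtain ⟨hq, hlt'⟩ := hmark rfl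
    let p : Fin n := ⟨q - 1, by lia⟩
    have hp : ∀ i : Fin n, (i : ℕ) < q ↔ i ≤ p := fun i => by
      rw [Fin.le_def]; exact Nat.lt_iff_le_pred hq
    exact ⟨b p + 2, fun i => hlt i p (Nat.le_pred_of_lt (hlt' i)), fun i => by
      rw [hp, add_le_add_iff_right, hb.le_iff_le], by simp⟩

theorem strictMono_snoc {b : Fin n → ℝ} (hb : StrictMono b) {y : ℝ} (hy : ∀ i, b i < y) :
    StrictMono (Fin.snoc b y : Fin (n + 1) → ℝ) := by
  intro i j hij
  induction j using Fin.lastCases with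
  | last =>
    obtain ⟨i, rfl⟩ := Fin.exists_castSucc_eq.2 hij.ne
    simpa using hy i
  | cast j =>
    obtain ⟨i, rfl⟩ := Fin.exists_castSucc_eq.2 (hij.trans (Fin.castSucc_lt_last j)).ne
    simpa using hb (Fin.castSucc_lt_castSucc_iff.1 hij)

theorem shiftCode_snoc_castSucc {b : Fin n → ℝ} {y : ℝ} (hy : ∀ i, b i < y) (j : Fin n) :
    shiftCode (Fin.snoc b y : Fin (n + 1) → ℝ) j.castSucc = shiftCode b j := by
  have hlast : ¬ y + 2 ≤ b j ∧ ¬ y + 2 = b j := by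
    constructor <;> linarith [hy j]
  simp only [shiftCode, card_filter, Fin.sum_univ_castSucc, Fin.exists_fin_succ',
    Fin.snoc_castSucc, Fin.snoc_last, hlast, if_false, add_zero, or_false]

theorem shiftCode_snoc_last {b : Fin n → ℝ} {x : ℕ × Bool} {y : ℝ} (hx : x.1 ≤ n)
    (hy : ∀ i : Fin n, (i : ℕ) < x.1 ↔ b i + 2 ≤ y) (hy' : x.2 ↔ ∃ i, b i + 2 = y) :
    shiftCode (Fin.snoc b y : Fin (n + 1) → ℝ) (Fin.last n) = x := by
  have hlast : ¬ y + 2 ≤ y ∧ ¬ y + 2 = y := by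
    constructor <;> linarith
  refine Prod.ext ?_ (Bool.eq_iff_iff.2 (decide_eq_true_iff.trans ?_))
  · simp only [shiftCode, card_filter, Fin.sum_univ_castSucc, Fin.snoc_castSucc, Fin.snoc_last,
      hlast, if_false, add_zero, ← hy]
    rw [← card_filter, Fin.card_filter_val_lt, min_eq_right hx]
  · simp only [Fin.exists_fin_succ', Fin.snoc_castSucc, Fin.snoc_last, hlast, or_false, hy']

theorem exists_shiftCode_eq {c : Fin n → ℕ × Bool} (hc : IsShiftCode c) :
    ∃ b : Fin n → ℝ, StrictMono b ∧ shiftCode b = c := by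
  induction n with
  | zero => exact ⟨0, Subsingleton.strictMono _, Subsingleton.elim _ _⟩
  | succ n ih =>
    induction c using Fin.snocCases with
    | snoc c x =>
      obtain ⟨hc, hx, hle, hmark⟩ := isShiftCode_snoc.1 hc
      obtain ⟨b, hb, rfl⟩ := ih hc
      obtain ⟨y, hby, hy, hy'⟩ := exists_next_term hb hx hle hmark
      refine ⟨Fin.snoc b y, strictMono_snoc hb hby, funext fun j => ?_⟩
      induction j using Fin.lastCases with
      | last => rw [Fin.snoc_last, shiftCode_snoc_last hx hy hy']
      | cast j => rw [Fin.snoc_castSucc, shiftCode_snoc_castSucc hby]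

end Realization

section TieSpace

variable {ι κ : Type*} {n : ℕ}

theorem mem_tieSpace_two {a v : ι → ℝ} : v ∈ tieSpace (fun _ => 2) a ↔
    ∀ i j, (a i = a j → v i = v j) ∧ (a i + 2 = a j → v i = v j) := by
  have h : v ∈ tieSpace (fun _ => 2) a ↔ ∀ α β : PileBox (fun _ : ι => 2),
    price a α = price a β → v α.1 = v β.1 := Iff.rfl
  simp only [h, price, Sigma.forall, Fin.forall_fin_two, Fin.val_zero, Fin.val_one, Nat.cast_zero,
    Nat.cast_one, mul_zero, mul_one, add_zero, ← add_assoc, add_left_inj]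
  exact ⟨fun h i j => ⟨((h i).1 j).1, ((h i).2 j).1⟩, fun h i => ⟨fun j => ⟨(h i j).1,
    fun hij => ((h j i).2 hij.symm).symm⟩, fun j => ⟨(h i j).2, (h i j).1⟩⟩⟩

theorem tieSpace_two_comp {f : κ → ι} (hf : f.Surjective) {b : ι → ℝ} (hb : b.Injective) :
    tieSpace (fun _ => 2) (b ∘ f) = (tieSpace (fun _ => 2) b).map (LinearMap.funLeft ℝ ℝ f) := by
  ext v
  rw [Submodule.mem_map]
  constructor
  · intro hv
    rw [mem_tieSpace_two] at hv
    have hfactor : ∀ i, v (Function.surjInv hf (f i)) = v i := fun i =>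
      (hv _ _).1 (congrArg b (Function.surjInv_eq hf _))
    refine ⟨v ∘ Function.surjInv hf, mem_tieSpace_two.2 ?_, funext hfactor⟩
    simpa only [hf.forall₂, Function.comp_apply, hfactor, hb.eq_iff] using hv
  · rintro ⟨w, hw, rfl⟩
    rw [mem_tieSpace_two, hf.forall₂] at hw
    exact mem_tieSpace_two.2 hw

theorem finrank_tieSpace_two_comp [Finite κ] {f : κ → ι} (hf : f.Surjective) {b : ι → ℝ}
    (hb : b.Injective) : Module.finrank ℝ (tieSpace (fun _ => 2) (b ∘ f)) =
      Module.finrank ℝ (tieSpace (fun _ => 2) b) := by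
  rw [tieSpace_two_comp hf hb]
  exact (Submodule.equivMapOfInjective _
    (LinearMap.funLeft_injective_of_surjective ℝ ℝ f hf) _).finrank_eq.symm

theorem surjective_sub_of_lt [LT ι] [WellFoundedLT ι] {s : Set ι} {p : s → ι}
    (hp : ∀ j, p j < j) : Function.Surjective fun (w : ι → ℝ) (j : s) => w j - w (p j) := by
  classical
  intro u
  let F : ∀ j : ι, (∀ i, i < j → ℝ) → ℝ := fun j w =>
    if h : j ∈ s then w (p ⟨j, h⟩) (hp ⟨j, h⟩) + u ⟨j, h⟩ else 0
  refine ⟨wellFounded_lt.fix F, funext fun j => ?_⟩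
  change wellFounded_lt.fix F j - wellFounded_lt.fix F (p j) = u j
  rw [wellFounded_lt.fix_eq F j]
  simp [F]

theorem finrank_tieSpace_add_markCount {b : Fin n → ℝ} (hb : StrictMono b) :
    Module.finrank ℝ (tieSpace (fun _ => 2) b) + markCount (shiftCode b) = n := by
  choose p hp using fun j : {j | (shiftCode b j).2} => shiftCode_snd.1 j.2
  let D : (Fin n → ℝ) →ₗ[ℝ] ({j | (shiftCode b j).2} → ℝ) :=
    LinearMap.funLeft ℝ ℝ (↑) - LinearMap.funLeft ℝ ℝ p
  have hD : D.range = ⊤ := LinearMap.range_eq_top.2 <| surjective_sub_of_lt fun j =>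
    hb.lt_iff_lt.1 (by linarith [hp j])
  have hker : D.ker = tieSpace (fun _ => 2) b := by
    ext w
    rw [mem_tieSpace_two, LinearMap.mem_ker]
    constructor
    · intro h i j
      refine ⟨fun hij => congrArg w (hb.injective hij), fun hij => ?_⟩
      let j' : {j | (shiftCode b j).2} := ⟨j, shiftCode_snd.2 ⟨i, hij⟩⟩
      have hpi : p j' = i := hb.injective (add_right_cancel ((hp j').trans hij.symm))
      exact hpi ▸ (sub_eq_zero.1 (congrFun h j')).symm
    · exact fun h => funext fun j => sub_eq_zero.2 ((h _ _).2 (hp j)).symm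
  have hmark : Module.finrank ℝ ({j | (shiftCode b j).2} → ℝ) = markCount (shiftCode b) := by
    rw [Module.finrank_fintype_fun_eq_card, Fintype.card_subtype]
    rfl
  have hrank := D.finrank_range_add_finrank_ker
  rw [hD, finrank_top, hker, hmark, Module.finrank_fin_fun] at hrank
  rw [add_comm, hrank]

end TieSpace

section Counting

variable {d k : ℕ}

theorem encard_image_eq_of_eq_iff {α β γ : Type*} {s : Set α} {F : α → β} {G : α → γ}
    (h : ∀ x ∈ s, ∀ y ∈ s, F x = F y ↔ G x = G y) : (F '' s).encard = (G '' s).encard := by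
  rw [Set.image_eq_range, Set.image_eq_range]
  have hker : ∀ x y : s, Setoid.ker (fun x : s => F x) x y ↔ Setoid.ker (fun x : s => G x) x y :=
    fun x y => h x x.2 y y.2
  exact Set.encard_congr <| (Setoid.quotientKerEquivRange _).symm.trans <|
    (Quotient.congrRight hker).trans (Setoid.quotientKerEquivRange _)

theorem faceDim_pileFace_two_add (hd : 0 < d) {r : ℕ} {f : Fin d → Fin r} (hf : f.Surjective)
    {b : Fin r → ℝ} (hb : StrictMono b) :
    faceDim (pileFace (fun _ => 2) (b ∘ f)) + r = d + markCount (shiftCode b) := by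
  have hdim := faceDim_pileFace_add_finrank_tieSpace (lam := fun _ => 2) (by simpa) (b ∘ f)
  have hrank := finrank_tieSpace_add_markCount hb
  rw [finrank_tieSpace_two_comp hf hb.injective] at hdim
  lia

/-- The pairs of a surjection `f : Fin d → Fin r` and an increasing sequence `b` of length `r` for
which the lower face minimizing the functional with coefficients `b ∘ f` and `1` has dimension
`d - k`. -/
def levelData (d k : ℕ) : Set (Σ r, (Fin d → Fin r) × (Fin r → ℝ)) :=
  {x | x.2.1.Surjective ∧ StrictMono x.2.2 ∧ markCount (shiftCode x.2.2) + k = x.1}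

theorem setOf_isLowerFace_eq_image_levelData (hd : 0 < d) (hkd : k ≤ d) :
    {F | IsLowerFace (pilePathPolytope fun _ : Fin d => 2) F ∧ faceDim F = d - k} =
      (fun x => pileFace (fun _ => 2) (x.2.2 ∘ x.2.1)) '' levelData d k := by
  ext F
  constructor
  · rintro ⟨hF, hdim⟩
    obtain ⟨a, rfl⟩ := (isLowerFace_iff (by simpa)).1 hF
    obtain ⟨r, f, b, hf, hb, rfl⟩ := exists_strictMono_comp_surjective a
    have := faceDim_pileFace_two_add hd hf hb
    exact ⟨⟨r, f, b⟩, ⟨hf, hb, by lia⟩, rfl⟩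
  · rintro ⟨⟨r, f, b⟩, ⟨hf, hb, hr : _ = r⟩, rfl⟩
    have := faceDim_pileFace_two_add hd hf hb
    exact ⟨(isLowerFace_iff (by simpa)).2 ⟨_, rfl⟩, by simp only; lia⟩

/-- The pairs of `levelData d k` with the increasing sequence replaced by its shift code. -/
noncomputable def levelCodes (d k : ℕ) : Finset (Σ r, (Fin d → Fin r) × (Fin r → ℕ × Bool)) :=
  (Finset.Icc k d).sigma fun r =>
    mapsWithImage d (Finset.univ : Finset (Fin r)) ×ˢ {c ∈ shiftCodes r r | markCount c + k = r}

theorem image_levelData_eq_levelCodes :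
    (fun x => (⟨x.1, x.2.1, shiftCode x.2.2⟩ : Σ r, (Fin d → Fin r) × (Fin r → ℕ × Bool))) ''
        levelData d k =
      levelCodes d k := by
  ext ⟨r, f, c⟩
  simp only [levelCodes, Finset.mem_coe, Finset.mem_sigma, Finset.mem_product, Finset.mem_filter,
    Finset.mem_Icc, mem_mapsWithImage_univ, mem_shiftCodes_self]
  constructor
  · rintro ⟨⟨r, f, b⟩, ⟨hf, hb, hr : _ = r⟩, hx⟩
    simp only [Sigma.mk.injEq] at hx
    obtain ⟨rfl, hx⟩ := hx
    obtain ⟨rfl, rfl⟩ := Prod.mk_inj.1 (eq_of_heq hx)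
    exact ⟨⟨by lia, Fin.le_of_surjective _ hf⟩, hf, isShiftCode_shiftCode hb, hr⟩
  · rintro ⟨-, hf, hc, hr⟩
    obtain ⟨b, hb, rfl⟩ := exists_shiftCode_eq hc
    exact ⟨⟨r, f, b⟩, ⟨hf, hb, hr⟩, rfl⟩

theorem encard_setOf_isLowerFace (hd : 0 < d) (hkd : k ≤ d) :
    {F | IsLowerFace (pilePathPolytope fun _ : Fin d => 2) F ∧ faceDim F = d - k}.encard =
      (levelCodes d k).card := by
  rw [setOf_isLowerFace_eq_image_levelData hd hkd, ← Set.encard_coe_eq_coe_finsetCard,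
    ← image_levelData_eq_levelCodes]
  refine encard_image_eq_of_eq_iff ?_
  rintro ⟨r, f, b⟩ ⟨hf, hb, -⟩ ⟨r', f', b'⟩ ⟨hf', hb', -⟩
  exact (pileFace_eq_iff (by simpa)).trans
    (sameShiftOrder_iff_price.symm.trans (sigma_shiftCode_eq_iff hf hf' hb hb').symm)

end Counting

theorem corollary4p4 (d k : ℕ) (hk : 1 ≤ k) (hkd : k ≤ d) :
    {F : Set ((Fin d → ℝ) × ℝ) |
        IsLowerFace (pilePathPolytope (fun _ : Fin d => 2)) F ∧ faceDim F = d - k}.encard =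
      ((∑ r ∈ Finset.Icc k d,
        (r - 1)! * Nat.stirlingSecond d r * r.choose k * (r + k).choose (k - 1) : ℕ) : ℕ∞) := by
  rw [encard_setOf_isLowerFace (hk.trans hkd) hkd, levelCodes, Finset.card_sigma]
  refine congrArg Nat.cast (Finset.sum_congr rfl fun r hr => ?_)
  obtain ⟨hkr, -⟩ := Finset.mem_Icc.1 hr
  rw [Finset.card_product, card_mapsWithImage, Finset.card_univ, Fintype.card_fin,
    ← Nat.mul_factorial_pred (Nat.ne_of_gt (hk.trans hkr))]
  linear_combination ((r - 1)! * Nat.stirlingSecond d r) * mul_card_shiftCodes_self hk hkr
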